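/- Graphs are finite connected multigraphs without loops (parallel edges are allowed). For such a graph $G$ with vertex set $V(G)$, a divisor is a function $D\colon V(G)\to\mathbb{Z}$, its degree is $\sum_v D(v)$, and for $f\colon V(G)\to\mathbb{Z}$ the principal divisor $\operatorname{div}(f)$ is given by $\operatorname{div}(f)(v)=\sum_{vw}(f(v)-f(w))$, the sum running over all edges $vw$ at $v$, counted with multiplicity. The Jacobian $\operatorname{Jac}(G)$ is the group of divisors of degree $0$ modulo principal divisors. The monodromy pairing $\operatorname{Jac}(G)\times\operatorname{Jac}(G)\to\mathbb{Q}/\mathbb{Z}$ sends the classes of $D_1,D_2$ to $\frac1m\sum_{v\in V(G)}D_2(v)f(v) \bmod \mathbb{Z}$, where $m\neq 0$ is an integer and $f\colon V(G)\to\mathbb{Z}$ is a function with $\operatorname{div}(f)=mD_1$; this does not depend on the choices. Theorem. Let $\Gamma$ be a finite abelian group of odd order with a nondegenerate symmetric bilinear pairing $\langle\cdot,\cdot\rangle\colon\Gamma\times\Gamma\to\mathbb{Q}/\mathbb{Z}$, and suppose that no prime $p\equiv 1 \pmod{24}$ divides $|\Gamma|$. Then there exist a graph $G$ and a group isomorphism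 $\varphi\colon\Gamma\to\operatorname{Jac}(G)$ that carries $\langle\cdot,\cdot\rangle$ to the monodromy pairing, that is, the monodromy pairing of $\varphi(x)$ and $\varphi(y)$ equals $\langle x,y\rangle$ for all $x,y\in\Gamma$. -/

import Mathlib

open scoped Graph

noncomputable section

namespace GraphJacobian

/-- A multigraph is connected if it has a vertex and any two of its vertices are joined by a
walk. -/
def Connected {V E : Type*} (G : Graph V E) : Prop :=
  V(G).Nonempty ∧ ∀ u ∈ V(G), ∀ v ∈ V(G), Relation.ReflTransGen G.Adj u v

/-- The number of edges with ends `v` and `w` (parallel edges are counted separately). -/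
def mult {V E : Type*} (G : Graph V E) (v w : V) : ℕ :=
  {e : E | G.IsLink e v w}.ncard

lemma mult_comm {V E : Type*} {G : Graph V E} (v w : V) : mult G v w = mult G w v := by
  simp only [mult, Graph.isLink_comm]

/-- Divisors: integral linear combinations of the vertices. -/
abbrev Divisor {V E : Type*} (G : Graph V E) : Type _ := V(G) → ℤ

variable {V E : Type*} (G : Graph V E) [Fintype V(G)]

/-- The degree of a divisor. -/
def degree : Divisor G →+ ℤ where
  toFun D := ∑ v, D v
  map_zero' := by simp
  map_add' D D' := by simp [Finset.sum_add_distrib]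

/-- `ord_v f` is the sum of `f v - f w` over the edges from `v` to a vertex `w`. -/
def ord (f : V(G) → ℤ) (v : V(G)) : ℤ :=
  ∑ w : V(G), (mult G v w : ℤ) * (f v - f w)

/-- The divisor of an integer-valued function on the vertices. -/
def divisor : (V(G) → ℤ) →+ Divisor G where
  toFun f := fun v ↦ ord G f v
  map_zero' := by ext v; simp [ord]
  map_add' f g := by
    ext v
    simp only [ord, Pi.add_apply, ← Finset.sum_add_distrib]
    exact Finset.sum_congr rfl fun w _ ↦ by ring

/-- Divisors of degree zero. -/
abbrev DivZero : AddSubgroup (Divisor G) := (degree G).ker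

/-- Principal divisors. -/
abbrev Principal : AddSubgroup (Divisor G) := (divisor G).range

/-- The Jacobian: the group of divisors of degree zero modulo principal divisors. -/
abbrev Jac : Type _ := DivZero G ⧸ (Principal G).addSubgroupOf (DivZero G)

open Classical in
/-- The monodromy pairing `Jac G × Jac G → ℚ/ℤ`. The pairing of the classes of `D₁` and `D₂` is
`(1 / m) * ∑ v, D₂ v * f v` where `m` is a nonzero integer and `f` an integer-valued function on
the vertices with `div f = m D₁`. For a connected graph this does not depend on any of the choices
(`monodromyPairing_mk`), and for a finite Jacobian such choices exist. -/
def monodromyPairing (x y : Jac G) : AddCircle (1 : ℚ) :=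
  if h : ∃ (D₁ D₂ : DivZero G) (m : ℤ) (f : V(G) → ℤ),
      (QuotientAddGroup.mk D₁ : Jac G) = x ∧ (QuotientAddGroup.mk D₂ : Jac G) = y ∧
        m ≠ 0 ∧ divisor G f = m • (D₁ : Divisor G) then
    (((1 / (h.choose_spec.choose_spec.choose : ℚ)) *
      ∑ v, ((h.choose_spec.choose : Divisor G) v : ℚ) *
        (h.choose_spec.choose_spec.choose_spec.choose v : ℚ) : ℚ) : AddCircle (1 : ℚ))
  else 0

variable {G}

/-- The operator `div` is symmetric. -/
lemma sum_divisor_mul (f g : V(G) → ℤ) :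
    ∑ v : V(G), divisor G f v * g v = ∑ v : V(G), divisor G g v * f v := by
  have key : ∀ f g : V(G) → ℤ, ∑ v : V(G), divisor G f v * g v =
      ∑ v : V(G), ∑ w : V(G), (mult G v w : ℤ) * (f v * g v) -
        ∑ v : V(G), ∑ w : V(G), (mult G v w : ℤ) * (f w * g v) := by
    intro f g
    rw [← Finset.sum_sub_distrib]
    refine Finset.sum_congr rfl fun v _ ↦ ?_
    change (∑ w : V(G), (mult G v w : ℤ) * (f v - f w)) * g v = _
    rw [Finset.sum_mul, ← Finset.sum_sub_distrib]
    exact Finset.sum_congr rfl fun w _ ↦ by ring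
  rw [key f g, key g f]
  congr 1
  · exact Finset.sum_congr rfl fun v _ ↦ Finset.sum_congr rfl fun w _ ↦ by ring
  · rw [Finset.sum_comm]
    exact Finset.sum_congr rfl fun v _ ↦ Finset.sum_congr rfl fun w _ ↦ by
      rw [mult_comm (G := G)]; ring

/-- On a connected graph, a function with trivial divisor is constant. -/
lemma const_of_divisor_eq_zero [Finite E(G)] (hG : Connected G) {f : V(G) → ℤ}
    (hf : divisor G f = 0) (a b : V(G)) : f a = f b := by
  have hsum : ∑ v : V(G), ∑ w : V(G), (mult G v w : ℤ) * (f v - f w) ^ 2 = 0 := by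
    have h1 : ∑ v : V(G), ∑ w : V(G), (mult G v w : ℤ) * (f v - f w) * f v = 0 := by
      refine Finset.sum_eq_zero fun v _ ↦ ?_
      rw [← Finset.sum_mul]
      have : divisor G f v = 0 := by rw [hf]; rfl
      change (divisor G f v) * f v = 0
      rw [this, zero_mul]
    have h2 : ∑ v : V(G), ∑ w : V(G), (mult G v w : ℤ) * (f v - f w) * f w = 0 := by
      have h3 : ∑ v : V(G), ∑ w : V(G), (mult G v w : ℤ) * (f w - f v) * f w = 0 := by
        rw [Finset.sum_comm]
        rw [← h1]
        exact Finset.sum_congr rfl fun v _ ↦ Finset.sum_congr rfl fun w _ ↦ by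
          rw [mult_comm (G := G)]
      rw [← neg_eq_zero, ← h3, ← Finset.sum_neg_distrib]
      refine Finset.sum_congr rfl fun v _ ↦ ?_
      rw [← Finset.sum_neg_distrib]
      exact Finset.sum_congr rfl fun w _ ↦ by ring
    rw [← sub_zero (0 : ℤ)]
    nth_rw 1 [← h1]
    rw [← h2, ← Finset.sum_sub_distrib]
    refine Finset.sum_congr rfl fun v _ ↦ ?_
    rw [← Finset.sum_sub_distrib]
    exact Finset.sum_congr rfl fun w _ ↦ by ring
  have hnn : ∀ v w : V(G), 0 ≤ (mult G v w : ℤ) * (f v - f w) ^ 2 := fun v w ↦ by positivity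
  have hadj : ∀ v w : V(G), G.Adj v w → f v = f w := by
    rintro v w ⟨e, he⟩
    have h1 := (Finset.sum_eq_zero_iff_of_nonneg
      (fun v _ ↦ Finset.sum_nonneg fun w _ ↦ hnn v w)).1 hsum v (Finset.mem_univ v)
    have h2 := (Finset.sum_eq_zero_iff_of_nonneg (fun w _ ↦ hnn v w)).1 h1 w (Finset.mem_univ w)
    have hm : mult G (v : V) w ≠ 0 := by
      have hfin : {e : E | G.IsLink e v w}.Finite :=
        (Set.toFinite E(G)).subset fun e he ↦ Graph.IsLink.edge_mem he
      exact (Set.ncard_pos hfin).2 ⟨e, he⟩ |>.ne'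
    rcases mul_eq_zero.1 h2 with h | h
    · exact absurd (by exact_mod_cast h) hm
    · exact sub_eq_zero.1 (pow_eq_zero_iff (two_ne_zero)|>.1 h)
  have hwalk : ∀ v : V, Relation.ReflTransGen G.Adj a v → ∀ hv : v ∈ V(G), f a = f ⟨v, hv⟩ := by
    intro v h
    induction h with
    | refl => intro _; rfl
    | tail _ h ih => intro hv; exact (ih h.left_mem).trans (hadj ⟨_, h.left_mem⟩ ⟨_, hv⟩ h)
  exact hwalk b (hG.2 a a.2 b b.2) b.2

/-- The value of the monodromy pairing of a connected graph, for any choice of representatives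
`D₁`, `D₂` and any choice of `m` and `f`. -/
theorem monodromyPairing_mk [Finite E(G)] (hG : Connected G) (D₁ D₂ : DivZero G) (m : ℤ)
    (f : V(G) → ℤ) (hm : m ≠ 0) (hf : divisor G f = m • (D₁ : Divisor G)) :
    monodromyPairing G (QuotientAddGroup.mk D₁) (QuotientAddGroup.mk D₂) =
      (((1 / (m : ℚ)) * ∑ v, ((D₂ : Divisor G) v : ℚ) * (f v : ℚ) : ℚ) : AddCircle (1 : ℚ)) := by
  have h : ∃ (D₁' D₂' : DivZero G) (m : ℤ) (f : V(G) → ℤ),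
      (QuotientAddGroup.mk D₁' : Jac G) = QuotientAddGroup.mk D₁ ∧
      (QuotientAddGroup.mk D₂' : Jac G) = QuotientAddGroup.mk D₂ ∧
        m ≠ 0 ∧ divisor G f = m • (D₁' : Divisor G) := ⟨D₁, D₂, m, f, rfl, rfl, hm, hf⟩
  rw [monodromyPairing, dif_pos h]
  obtain ⟨e1, e2, hm', hf'⟩ := h.choose_spec.choose_spec.choose_spec.choose_spec
  generalize h.choose_spec.choose_spec.choose_spec.choose = f' at *
  generalize h.choose_spec.choose_spec.choose = m' at *
  generalize h.choose_spec.choose = D₂' at *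
  generalize h.choose = D₁' at *
  obtain ⟨g, hg⟩ : ∃ g, divisor G g = -(D₁' : Divisor G) + D₁ := QuotientAddGroup.eq.1 e1
  obtain ⟨k, hk⟩ : ∃ k, divisor G k = -(D₂' : Divisor G) + D₂ := QuotientAddGroup.eq.1 e2
  have hconst : divisor G (m' • f - m • f' - (m * m') • g) = 0 := by
    rw [map_sub, map_sub, map_zsmul, map_zsmul, map_zsmul, hf, hf', hg]
    module
  have hdeg : ∑ v, (D₂ : Divisor G) v = 0 := D₂.2
  obtain ⟨a, ha⟩ := hG.1
  have hc : ∀ v, m' * f v - m * f' v - m * m' * g v =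
      (m' • f - m • f' - (m * m') • g) ⟨a, ha⟩ := fun v ↦ by
    simpa using const_of_divisor_eq_zero hG hconst v ⟨a, ha⟩
  generalize (m' • f - m • f' - (m * m') • g) ⟨a, ha⟩ = c at hc
  have hD : ∀ v, (D₂' : Divisor G) v = (D₂ : Divisor G) v - divisor G k v := fun v ↦ by
    rw [hk]; simp
  have hsymm : ∑ v, divisor G k v * f' v = m' * ∑ v, (D₁' : Divisor G) v * k v := by
    rw [sum_divisor_mul, hf', Finset.mul_sum]
    exact Finset.sum_congr rfl fun v _ ↦ by simp [mul_assoc]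
  have hS : m * ∑ v, (D₂' : Divisor G) v * f' v = m' * (∑ v, (D₂ : Divisor G) v * f v)
      - m * m' * (∑ v, (D₂ : Divisor G) v * g v + ∑ v, (D₁' : Divisor G) v * k v) := by
    have h1 : ∑ v, (D₂' : Divisor G) v * f' v =
        ∑ v, (D₂ : Divisor G) v * f' v - m' * ∑ v, (D₁' : Divisor G) v * k v := by
      rw [← hsymm, ← Finset.sum_sub_distrib]
      exact Finset.sum_congr rfl fun v _ ↦ by rw [hD]; ring
    have h2 : m * ∑ v, (D₂ : Divisor G) v * f' v = m' * (∑ v, (D₂ : Divisor G) v * f v)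
        - m * m' * (∑ v, (D₂ : Divisor G) v * g v) - c * ∑ v, (D₂ : Divisor G) v := by
      simp only [Finset.mul_sum, ← Finset.sum_sub_distrib]
      exact Finset.sum_congr rfl fun v _ ↦ by rw [← hc v]; ring
    rw [h1, mul_sub, h2, hdeg]; ring
  have hQ : (m : ℚ) * ∑ v, ((D₂' : Divisor G) v : ℚ) * f' v =
      m' * (∑ v, ((D₂ : Divisor G) v : ℚ) * f v)
      - m * m' * ((∑ v, (D₂ : Divisor G) v * g v + ∑ v, (D₁' : Divisor G) v * k v : ℤ) : ℚ) := by
    exact_mod_cast hS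
  have hmq : (m : ℚ) ≠ 0 := by exact_mod_cast hm
  have hmq' : (m' : ℚ) ≠ 0 := by exact_mod_cast hm'
  rw [← sub_eq_zero, ← AddCircle.coe_sub, AddCircle.coe_eq_zero_iff]
  refine ⟨-(∑ v, (D₂ : Divisor G) v * g v + ∑ v, (D₁' : Divisor G) v * k v), ?_⟩
  rw [zsmul_eq_mul, mul_one, Int.cast_neg]
  field_simp
  linear_combination (-1) * hQ

end GraphJacobian

end

namespace GraphJacobian

open Matrix

/-! A reduced Laplacian `M` presents the Jacobian as the cokernel of `M`, with the monodromy pairing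
given by the inverse of `M` modulo 1. It is therefore enough to find generators of `Γ` whose Gram
matrix is, modulo 1, the inverse of an integral matrix with the sign conditions of a reduced
Laplacian (`ker_toGroup`, `monodromyPairing_equivJac`).

Such presentations can be added along orthogonal sums, by gluing graphs at a vertex
(`HasGramPresentation.sup`). In odd order, polarization yields cyclic orthogonal summands of prime
power order (`exists_selfPairing_primitive`), which reduces everything to cyclic groups
(`hasGramPresentation_of_odd`).

On a cyclic group of order `n = p ^ r` with generator `x` and `⟨x, x⟩ = a / n`, only the quadratic
character of `a` modulo `p` matters (`exists_generator_of_isSquare`). A path with `k` edges whose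
ends are joined by `c` further edges has cyclic Jacobian of order `k * c + 1` and realizes the class
of `k`. Taking `k = 1` gives the squares. If `p` is not 1 modulo 24, one of -1, 2, 3 is a
nonresidue, and a path (`hasGramPresentation_of_path`) or one extra graph
(`hasGramPresentation_of_three`) gives the nonsquares. -/

/-- `M` is a reduced Laplacian of a multigraph, `N` is its inverse, and `g` is a generating family
of `Γ` whose Gram matrix with respect to `B` is `N` modulo `1`. -/
structure IsGramPresentation {Γ : Type*} [AddCommGroup Γ] (B : Γ →+ Γ →+ AddCircle (1 : ℚ))
    {ι : Type*} [Fintype ι] [DecidableEq ι] (M : Matrix ι ι ℤ) (N : Matrix ι ι ℚ) (g : ι → Γ) :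
    Prop where
  symm : ∀ i j, M i j = M j i
  offDiag : ∀ i j, i ≠ j → M i j ≤ 0
  rowSum : ∀ i, 0 ≤ ∑ j, M i j
  mul_inv : M.map (Int.cast : ℤ → ℚ) * N = 1
  closure : AddSubgroup.closure (Set.range g) = ⊤
  gram : ∀ i j, B (g i) (g j) = (N i j : AddCircle (1 : ℚ))

/-- The edge multiplicities of the graph on `Option ι` with reduced Laplacian `M`. -/
def weight {ι : Type*} [Fintype ι] [DecidableEq ι] (M : Matrix ι ι ℤ) :
    Option ι → Option ι → ℕ
  | none, none => 0
  -- What a row sum of the reduced Laplacian leaves over is the number of edges to the deleted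
  -- vertex `none`.
  | some i, none => (∑ j, M i j).toNat
  | none, some i => (∑ j, M i j).toNat
  | some i, some j => if i = j then 0 else (-M i j).toNat

/-- The multigraph on `V` with `W v w` edges between `v` and `w`. -/
def ofWeight {V : Type*} (W : V → V → ℕ) (hW : ∀ v w, W v w = W w v) : Graph V (Sym2 V × ℕ) where
  vertexSet := Set.univ
  IsLink e v w := e.1 = s(v, w) ∧ e.2 < W v w
  isLink_symm e _ := ⟨fun v w h ↦ by rwa [Sym2.eq_swap, hW] at h⟩
  eq_or_eq_of_isLink_of_isLink := by
    rintro ⟨e, k⟩ x y v w ⟨h, -⟩ ⟨h', -⟩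
    have := Sym2.eq_iff.1 (h.symm.trans h')
    tauto
  left_mem_of_isLink := fun _ _ _ _ ↦ Set.mem_univ _

/-! ### Multigraphs with prescribed edge multiplicities. -/

section ofWeight

variable {V : Type*} {W : V → V → ℕ} {hW : ∀ v w, W v w = W w v}

lemma mult_ofWeight (v w : V) : mult (ofWeight W hW) v w = W v w := by
  have : {e | (ofWeight W hW).IsLink e v w} = (fun k ↦ (s(v, w), k)) '' Set.Iio (W v w) := by
    ext ⟨e, k⟩
    simp only [ofWeight, Set.mem_ofPred_eq, Set.mem_image, Set.mem_Iio, Prod.mk.injEq]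
    constructor
    · rintro ⟨rfl, h⟩
      exact ⟨k, h, rfl, rfl⟩
    · rintro ⟨_, h, rfl, rfl⟩
      exact ⟨rfl, h⟩
  rw [mult, this, Set.ncard_image_of_injective _ (fun a b h ↦ (Prod.mk.inj h).2)]
  simp [Set.ncard_eq_toFinset_card']

lemma finite_edgeSet_ofWeight [Finite V] : Finite E(ofWeight W hW) := by
  have : E(ofWeight W hW) ⊆
      ⋃ p : V × V, (fun k ↦ (s(p.1, p.2), k)) '' Set.Iio (W p.1 p.2) := by
    rintro ⟨e, k⟩ ⟨v, w, h, hk⟩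
    exact Set.mem_iUnion.2 ⟨(v, w), k, hk, Prod.ext h.symm rfl⟩
  exact ((Set.finite_iUnion fun p ↦ (Set.finite_Iio _).image _).subset this).to_subtype

lemma loopless_ofWeight (h0 : ∀ v, W v v = 0) : (ofWeight W hW).Loopless where
  not_isLoopAt e v h := by
    have h2 : e.2 < W v v := h.2
    simp [h0] at h2

end ofWeight

/-! ### The graph with a given reduced Laplacian. -/

section Presentation

variable {ι : Type*} [Fintype ι] [DecidableEq ι] {M : Matrix ι ι ℤ} {N : Matrix ι ι ℚ}

lemma weight_comm (hM : ∀ i j, M i j = M j i) (v w : Option ι) : weight M v w = weight M w v := by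
  rcases v with _ | i <;> rcases w with _ | j <;> simp only [weight, hM, eq_comm]

lemma weight_self (v : Option ι) : weight M v v = 0 := by
  rcases v with _ | i <;> simp [weight]

variable (hM : ∀ i j, M i j = M j i)

/-- The multigraph on `Option ι` with reduced Laplacian `M`. -/
abbrev laplacianGraph : Graph (Option ι) (Sym2 (Option ι) × ℕ) :=
  ofWeight (weight M) (weight_comm hM)

/-- The element of `Option ι` as a vertex. -/
abbrev vert (v : Option ι) : V(laplacianGraph hM) := ⟨v, Set.mem_univ v⟩

instance : Fintype V(laplacianGraph hM) := inferInstanceAs (Fintype (Set.univ : Set (Option ι)))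

lemma sum_vert {A : Type*} [AddCommMonoid A] (F : V(laplacianGraph hM) → A) :
    ∑ v, F v = F (vert hM none) + ∑ i, F (vert hM (some i)) := by
  rw [← Fintype.sum_option (fun v ↦ F (vert hM v))]
  exact Fintype.sum_equiv (Equiv.Set.univ _) _ _ fun v ↦ rfl

variable (hoff : ∀ i j, i ≠ j → M i j ≤ 0) (hrow : ∀ i, 0 ≤ ∑ j, M i j)

include hoff hrow in
lemma divisor_vert_some (f : V(laplacianGraph hM) → ℤ) (i : ι) :
    divisor _ f (vert hM (some i)) =
      ∑ j, M i j * (f (vert hM (some j)) - f (vert hM none)) := by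
  change ord _ f _ = _
  rw [ord]
  rw [sum_vert]
  simp only [mult_ofWeight, weight]
  rw [Int.toNat_of_nonneg (hrow i), Finset.sum_mul, ← Finset.sum_add_distrib]
  refine Finset.sum_congr rfl fun j _ ↦ ?_
  split_ifs with h
  · subst h; simp
  · rw [Int.toNat_of_nonneg (by linarith [hoff i j h])]; ring

end Presentation

end GraphJacobian

/-! ### From a Gram presentation to the Jacobian and its pairing. -/

namespace GraphJacobian

open Matrix

lemma coe_intCast (k : ℤ) : ((k : ℚ) : AddCircle (1 : ℚ)) = 0 :=
  (AddCircle.coe_eq_zero_iff 1).2 ⟨k, by simp⟩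

namespace IsGramPresentation

variable {Γ : Type*} [AddCommGroup Γ] {B : Γ →+ Γ →+ AddCircle (1 : ℚ)}
  {ι : Type*} [Fintype ι] [DecidableEq ι] {M : Matrix ι ι ℤ} {N : Matrix ι ι ℚ} {g : ι → Γ}

lemma inv_mul (h : IsGramPresentation B M N g) : N * M.map (Int.cast : ℤ → ℚ) = 1 :=
  mul_eq_one_comm.1 h.mul_inv

lemma inv_symm (h : IsGramPresentation B M N g) : Nᵀ = N := by
  have hM : (M.map (Int.cast : ℤ → ℚ))ᵀ = M.map Int.cast := by
    ext i j; simp [h.symm i j]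
  have h1 : Nᵀ * M.map (Int.cast : ℤ → ℚ) = 1 := by
    rw [← hM, ← transpose_mul, h.mul_inv, transpose_one]
  exact left_inv_eq_right_inv h1 h.mul_inv

/-- The linear combination of `g` with coefficients `x`. -/
def comb (g : ι → Γ) : (ι → ℤ) →+ Γ where
  toFun x := ∑ i, x i • g i
  map_zero' := by simp
  map_add' x y := by simp [add_smul, Finset.sum_add_distrib]

lemma comb_surjective (h : IsGramPresentation B M N g) : Function.Surjective (comb g) := by
  rw [← AddMonoidHom.range_eq_top, eq_top_iff, ← h.closure, AddSubgroup.closure_le]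
  rintro _ ⟨i, rfl⟩
  exact ⟨Pi.single i 1, by simp [comb, Pi.single_apply]⟩

lemma pairing_comb (h : IsGramPresentation B M N g) (x y : ι → ℤ) :
    B (comb g x) (comb g y) =
      (∑ i, ∑ j, (x i : ℚ) * y j * N i j : ℚ) := by
  have hsum : ∀ F : ι → ℚ, ((∑ i, F i : ℚ) : AddCircle (1 : ℚ)) = ∑ i, (F i : AddCircle (1 : ℚ)) :=
    fun F ↦ map_sum (QuotientAddGroup.mk' (AddSubgroup.zmultiples (1 : ℚ))) F _
  simp only [comb, AddMonoidHom.coe_mk, ZeroHom.coe_mk, map_sum, AddMonoidHom.finsetSum_apply, hsum,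
    map_zsmul, AddMonoidHom.smul_apply, h.gram, ← AddCircle.coe_zsmul]
  rw [Finset.sum_comm]
  refine Finset.sum_congr rfl fun j _ ↦ ?_
  rw [Finset.smul_sum]
  refine Finset.sum_congr rfl fun i _ ↦ ?_
  rw [← AddCircle.coe_zsmul]
  simp only [zsmul_eq_mul]
  exact congrArg _ (by ring)

/-- If `M f = m x` then `x N = f / m`. -/
lemma eq_of_mulVec (h : IsGramPresentation B M N g) {x f : ι → ℤ} {m : ℤ}
    (hf : ∀ i, ∑ j, M i j * f j = m * x i) (j : ι) :
    (m : ℚ) * ∑ i, (x i : ℚ) * N i j = f j := by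
  have h1 : M.map (Int.cast : ℤ → ℚ) *ᵥ (fun j ↦ (f j : ℚ)) = fun i ↦ (m : ℚ) * x i := by
    ext i
    simpa [mulVec, dotProduct] using congrArg (Int.cast : ℤ → ℚ) (hf i)
  have h2 := congrArg (N *ᵥ ·) h1
  simp only [mulVec_mulVec, h.inv_mul, one_mulVec] at h2
  rw [congrFun h2 j, mulVec, dotProduct, Finset.mul_sum]
  refine Finset.sum_congr rfl fun i _ ↦ ?_
  rw [← congrFun (congrFun h.inv_symm i) j, transpose_apply]
  ring

/-- If `f = x N` then `M f = x`. -/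
lemma mulVec_of_eq (h : IsGramPresentation B M N g) {x f : ι → ℤ}
    (hf : ∀ j, ∑ i, (x i : ℚ) * N i j = f j) (i : ι) :
    ∑ j, M i j * f j = x i := by
  have h1 : N *ᵥ (fun j ↦ (x j : ℚ)) = fun i ↦ (f i : ℚ) := by
    ext i
    rw [← hf i, mulVec, dotProduct]
    refine Finset.sum_congr rfl fun j _ ↦ ?_
    rw [← congrFun (congrFun h.inv_symm i) j, transpose_apply, mul_comm]
  have h2 := congrFun (congrArg (M.map (Int.cast : ℤ → ℚ) *ᵥ ·) h1) i
  simp only [mulVec_mulVec, h.mul_inv, one_mulVec] at h2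
  have h3 : (x i : ℚ) = ∑ j, (M i j : ℚ) * f j := by rw [h2]; rfl
  exact_mod_cast h3.symm

variable (h : IsGramPresentation B M N g)

/-- The group element defined by a divisor of degree zero. -/
def toGroup : DivZero (laplacianGraph h.symm) →+ Γ where
  toFun D := comb g fun i ↦ (D : Divisor _) (vert h.symm (some i))
  map_zero' := (comb g).map_zero
  map_add' _ _ := (comb g).map_add _ _

lemma toGroup_surjective : Function.Surjective (toGroup h) := by
  intro z
  obtain ⟨x, rfl⟩ := h.comb_surjective z
  let D : Divisor (laplacianGraph h.symm) := fun v ↦ v.1.elim (-∑ i, x i) x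
  have hD : degree _ D = 0 := by
    change ∑ v, D v = 0
    rw [sum_vert]
    simp [D]
  exact ⟨⟨D, hD⟩, rfl⟩

/-- Invertibility of `M` recovers a function from its divisor, up to its value at `none`. -/
lemma sum_of_divisor_eq {D : Divisor (laplacianGraph h.symm)} {m : ℤ}
    {f : V(laplacianGraph h.symm) → ℤ} (hf : divisor _ f = m • D) (j : ι) :
    (m : ℚ) * ∑ i, (D (vert h.symm (some i)) : ℚ) * N i j =
      ((f (vert h.symm (some j)) - f (vert h.symm none) : ℤ) : ℚ) := by
  refine h.eq_of_mulVec (f := fun j ↦ f (vert h.symm (some j)) - f (vert h.symm none))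
    (x := fun i ↦ D (vert h.symm (some i))) (fun i ↦ ?_) j
  rw [← divisor_vert_some h.symm h.offDiag h.rowSum, hf]
  simp

/-- The indicator function of the vertices not reachable from `none` has divisor zero and vanishes
at `none`. As `M` is invertible, it vanishes everywhere. -/
lemma connected : Connected (laplacianGraph h.symm) := by
  classical
  refine ⟨⟨none, Set.mem_univ _⟩, ?_⟩
  let R := Relation.ReflTransGen (laplacianGraph h.symm).Adj none
  have key : ∀ v, R v := by
    let f : V(laplacianGraph h.symm) → ℤ := fun v ↦ if R v.1 then 0 else 1
    have hf : divisor (laplacianGraph h.symm) f = (1 : ℤ) • (0 : Divisor _) := by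
      ext v
      change ∑ w : V(laplacianGraph h.symm), (mult _ (v : Option ι) w : ℤ) * (f v - f w) = _
      rw [smul_zero]
      refine Finset.sum_eq_zero fun w _ ↦ ?_
      by_cases hvw : (laplacianGraph h.symm).Adj v w
      · have : R v ↔ R w := ⟨fun hv ↦ hv.tail hvw, fun hw ↦ hw.tail hvw.symm⟩
        simp [f, this]
      · have : {e | (laplacianGraph h.symm).IsLink e (v : Option ι) w} = ∅ :=
          Set.eq_empty_of_forall_notMem fun e he ↦ hvw ⟨e, he⟩
        simp [mult, this]
    rintro (_ | j)
    · exact .refl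
    · have hj := h.sum_of_divisor_eq hf j
      have h0 : f (vert h.symm none) = 0 := if_pos .refl
      rw [h0] at hj
      have hj' : f (vert h.symm (some j)) = 0 := by simpa using hj.symm
      by_contra hR
      exact one_ne_zero ((if_neg hR).symm.trans hj')
  have hsymm : ∀ v, Relation.ReflTransGen (laplacianGraph h.symm).Adj v none := fun v ↦
    Relation.ReflTransGen.stdSymm.symm _ _ (key v)
  exact fun u _ v _ ↦ (hsymm u).trans (key v)

/-- By nondegeneracy, a combination `∑ x i • g i` is zero exactly when it pairs trivially with all
generators, that is, when `x N` is integral, and then `x = M (x N)` comes from a function vanishing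
at `none`. The coordinate at `none` takes care of itself because both degrees are zero. -/
lemma ker_toGroup (hnondeg : ∀ x, (∀ y, B x y = 0) → x = 0) :
    (toGroup h).ker =
      (Principal (laplacianGraph h.symm)).addSubgroupOf (DivZero (laplacianGraph h.symm)) := by
  ext ⟨D, hD⟩
  have hpair : ∀ y : ι → ℤ, B (toGroup h ⟨D, hD⟩) (comb g y) =
      ((∑ j, (y j : ℚ) * ∑ i, (D (vert h.symm (some i)) : ℚ) * N i j : ℚ) :
        AddCircle (1 : ℚ)) := fun y ↦ by
    refine (h.pairing_comb _ y).trans (congrArg _ ?_)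
    rw [Finset.sum_comm]
    refine Finset.sum_congr rfl fun j _ ↦ ?_
    rw [Finset.mul_sum]
    exact Finset.sum_congr rfl fun i _ ↦ by ring
  rw [AddMonoidHom.mem_ker, AddSubgroup.mem_addSubgroupOf]
  constructor
  · intro h0
    have h1 : ∀ j, ∃ k : ℤ, ∑ i, (D (vert h.symm (some i)) : ℚ) * N i j = k := fun j ↦ by
      have := hpair (Pi.single j 1)
      rw [h0, map_zero, AddMonoidHom.zero_apply] at this
      obtain ⟨k, hk⟩ := (AddCircle.coe_eq_zero_iff _).1 this.symm
      refine ⟨k, ?_⟩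
      simpa [Pi.single_apply] using hk.symm
    choose k hk using h1
    let f : V(laplacianGraph h.symm) → ℤ := fun v ↦ v.1.elim 0 k
    have hs : ∀ i, divisor _ f (vert h.symm (some i)) = D (vert h.symm (some i)) := fun i ↦ by
      rw [divisor_vert_some h.symm h.offDiag h.rowSum]
      simpa [f] using h.mulVec_of_eq hk i
    refine ⟨f, funext ?_⟩
    have hd1 : ∑ v, D v = 0 := hD
    have hd2 : ∑ v, divisor _ f v = 0 := by
      simpa [show divisor (laplacianGraph h.symm) 1 = 0 by
        ext v; exact Finset.sum_eq_zero fun w _ ↦ by simp] using sum_divisor_mul f 1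
    rw [sum_vert] at hd1 hd2
    simp only [hs] at hd2
    rintro ⟨_ | i, -⟩
    · change divisor _ f (vert h.symm none) = D (vert h.symm none)
      linarith
    · exact hs i
  · rintro ⟨f, hf⟩
    refine hnondeg _ fun z ↦ ?_
    obtain ⟨y, rfl⟩ := h.comb_surjective z
    have hf' : divisor (laplacianGraph h.symm) f = (1 : ℤ) • D := hf.trans (one_smul _ _).symm
    have := h.sum_of_divisor_eq hf'
    simp only [Int.cast_one, one_mul] at this
    rw [hpair]
    simp only [this]
    exact_mod_cast coe_intCast
      (∑ j, y j * (f (vert h.symm (some j)) - f (vert h.symm none)))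

/-- The Jacobian of the graph of a Gram presentation. -/
noncomputable def equivJac (hnondeg : ∀ x, (∀ y, B x y = 0) → x = 0) :
    Γ ≃+ Jac (laplacianGraph h.symm) :=
  ((QuotientAddGroup.quotientAddEquivOfEq (h.ker_toGroup hnondeg)).symm.trans
    (QuotientAddGroup.quotientKerEquivOfSurjective _ h.toGroup_surjective)).symm

lemma equivJac_toGroup (hnondeg : ∀ x, (∀ y, B x y = 0) → x = 0)
    (D : DivZero (laplacianGraph h.symm)) :
    h.equivJac hnondeg (toGroup h D) = QuotientAddGroup.mk D :=
  (AddEquiv.symm_apply_eq _).2 rfl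

/-- The order of `Γ` serves as the integer `m`: it kills the class of `D`, so `m D = div f`. Up to a
constant, which degree zero makes harmless, `f / m` is `x N`, with `x` the restriction of `D` away
from `none`. -/
lemma monodromyPairing_equivJac [Finite Γ] (hnondeg : ∀ x, (∀ y, B x y = 0) → x = 0) (x y : Γ) :
    monodromyPairing _ (h.equivJac hnondeg x) (h.equivJac hnondeg y) = B x y := by
  obtain ⟨D, rfl⟩ := h.toGroup_surjective x
  obtain ⟨D', rfl⟩ := h.toGroup_surjective y
  have hcard : (Nat.card Γ : ℤ) ≠ 0 := by exact_mod_cast Nat.card_pos.ne'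
  have hmem : (Nat.card Γ : ℤ) • D ∈ (toGroup h).ker := by
    rw [AddMonoidHom.mem_ker, map_zsmul, natCast_zsmul, card_nsmul_eq_zero']
  rw [h.ker_toGroup hnondeg, AddSubgroup.mem_addSubgroupOf] at hmem
  obtain ⟨f, hf⟩ := hmem
  have hfin : Finite E(laplacianGraph h.symm) := finite_edgeSet_ofWeight
  rw [equivJac_toGroup, equivJac_toGroup,
    monodromyPairing_mk h.connected D D' (Nat.card Γ) f hcard hf]
  refine Eq.trans (congrArg _ ?_) (h.pairing_comb _ _).symm
  have hq : (((Nat.card Γ : ℤ)) : ℚ) ≠ 0 := by exact_mod_cast hcard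
  have hD' : ∑ v, D'.1 v = 0 := D'.2
  have hD'' : (D'.1 (vert h.symm none) : ℚ) =
      -∑ i, (D'.1 (vert h.symm (some i)) : ℚ) := by
    rw [sum_vert] at hD'
    rw [eq_neg_iff_add_eq_zero]
    exact_mod_cast hD'
  have hN := h.sum_of_divisor_eq hf
  rw [one_div, inv_mul_eq_iff_eq_mul₀ hq, sum_vert, hD'', neg_mul, Finset.sum_mul,
    ← sub_eq_neg_add, ← Finset.sum_sub_distrib, Finset.sum_comm, Finset.mul_sum]
  refine Finset.sum_congr rfl fun j _ ↦ ?_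
  rw [← mul_sub, ← Int.cast_sub, ← hN j, mul_left_comm, Finset.mul_sum]
  congr 1
  exact Finset.sum_congr rfl fun i _ ↦ by ring

end IsGramPresentation

end GraphJacobian

/-! ### Presentable pairings, and their orthogonal sums. -/

namespace GraphJacobian

open Matrix

/-- The pairing `B` is presented by some reduced Laplacian. -/
def HasGramPresentation {Γ : Type*} [AddCommGroup Γ] (B : Γ →+ Γ →+ AddCircle (1 : ℚ)) : Prop :=
  ∃ (ι : Type) (_ : Fintype ι) (_ : DecidableEq ι) (M : Matrix ι ι ℤ) (N : Matrix ι ι ℚ)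
    (g : ι → Γ), IsGramPresentation B M N g

section

variable {Γ : Type*} [AddCommGroup Γ] {B : Γ →+ Γ →+ AddCircle (1 : ℚ)}

lemma hasGramPresentation_of_subsingleton [Subsingleton Γ] : HasGramPresentation B :=
  ⟨Empty, inferInstance, inferInstance, 0, 0, Empty.elim,
    { symm := by simp
      offDiag := by simp
      rowSum := by simp
      mul_inv := Subsingleton.elim _ _
      closure := Subsingleton.elim _ _
      gram := by simp }⟩

/-- The restriction of a pairing to a subgroup. -/
def restrict (B : Γ →+ Γ →+ AddCircle (1 : ℚ)) (H : AddSubgroup Γ) :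
    H →+ H →+ AddCircle (1 : ℚ) :=
  (B.comp H.subtype).compl₂ H.subtype

@[simp]
lemma restrict_apply (H : AddSubgroup Γ) (x y : H) : restrict B H x y = B x y := rfl

/-- Gluing two graphs at their vertices `none` makes the reduced Laplacian, and hence its inverse,
block diagonal. Orthogonality gives the zero blocks of the Gram matrix. -/
lemma HasGramPresentation.sup {H K : AddSubgroup Γ} (hH : HasGramPresentation (restrict B H))
    (hK : HasGramPresentation (restrict B K)) (hsup : H ⊔ K = ⊤) (hsymm : ∀ x y, B x y = B y x)
    (horth : ∀ x ∈ H, ∀ y ∈ K, B x y = 0) : HasGramPresentation B := by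
  obtain ⟨ι, _, _, M, N, g, h⟩ := hH
  obtain ⟨κ, _, _, M', N', g', h'⟩ := hK
  refine ⟨ι ⊕ κ, inferInstance, inferInstance, fromBlocks M 0 0 M', fromBlocks N 0 0 N',
    Sum.elim (fun i ↦ (g i : Γ)) (fun i ↦ (g' i : Γ)), ?_, ?_, ?_, ?_, ?_, ?_⟩
  · rintro (i | i) (j | j)
    · simpa using h.symm i j
    · simp
    · simp
    · simpa using h'.symm i j
  · rintro (i | i) (j | j) hij
    · simpa using h.offDiag i j (by simpa using hij)
    · simp
    · simp
    · simpa using h'.offDiag i j (by simpa using hij)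
  · rintro (i | i)
    · simpa using h.rowSum i
    · simpa using h'.rowSum i
  · rw [fromBlocks_map, fromBlocks_multiply, h.mul_inv, h'.mul_inv]
    simp
  · have hmap : ∀ {ι : Type} (H : AddSubgroup Γ) (g : ι → H),
        AddSubgroup.closure (Set.range g) = ⊤ →
          AddSubgroup.closure (Set.range fun i ↦ (g i : Γ)) = H := by
      intro ι H g hg
      have := congrArg (AddSubgroup.map H.subtype) hg
      rw [AddMonoidHom.map_closure, ← Set.range_comp] at this
      simpa [← AddMonoidHom.range_eq_map, Function.comp_def] using this
    rw [Set.Sum.elim_range, AddSubgroup.closure_union, hmap H g h.closure, hmap K g' h'.closure,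
      hsup]
  · rintro (i | i) (j | j)
    · simpa using h.gram i j
    · simpa using horth _ (g i).2 _ (g' j).2
    · simpa using (hsymm _ _).trans (horth _ (g j).2 _ (g' i).2)
    · simpa using h'.gram i j

/-! ### Cyclic groups -/

/-- The entries of the reduced Laplacian of a path with `k` edges whose ends are joined by `c`
further edges. -/
def pathEntry (k c i j : ℕ) : ℤ :=
  (if i = j then (if i + 1 = k then (c + 1 : ℤ) else 2) else 0) -
    (if i + 1 = j then 1 else 0) - (if j + 1 = i then 1 else 0)

/-- A row acts as a second difference. Index `j` is the vertex at distance `j + 1` from `none` along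
the path, so `F 0 = 0` is the value at `none`. The last vertex has no successor, only `c` extra
edges to `none`. -/
lemma sum_pathEntry {R : Type*} [CommRing R] (k c : ℕ) (F : ℕ → R) (h0 : F 0 = 0) {i : ℕ}
    (hi : i < k) : ∑ j : Fin k, (pathEntry k c i j : R) * F (j + 1) =
      (if i + 1 = k then (c + 1 : R) else 2) * F (i + 1) -
        (if i + 1 = k then 0 else F (i + 2)) - F i := by
  rw [Fin.sum_univ_eq_sum_range (fun j ↦ (pathEntry k c i j : R) * F (j + 1))]
  have h1 : ∀ j, (pathEntry k c i j : R) * F (j + 1) =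
      (if i = j then (if i + 1 = k then (c + 1 : R) else 2) * F (j + 1) else 0) -
        (if i + 1 = j then F (j + 1) else 0) - (if j + 1 = i then F (j + 1) else 0) := fun j ↦ by
    unfold pathEntry
    split_ifs <;> push_cast <;> ring
  simp only [h1, Finset.sum_sub_distrib]
  rw [Finset.sum_ite_eq, Finset.sum_ite_eq, if_pos (Finset.mem_range.2 hi)]
  congr 1
  · congr 1
    simp only [Finset.mem_range]
    split_ifs <;> first | rfl | omega
  · cases i with
    | zero => simp [h0]
    | succ i => simp [show i < k by omega]

lemma hasGramPresentation_of_path {y : Γ} (hy : AddSubgroup.closure {y} = ⊤) {n k c : ℕ}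
    (hn : n = k * c + 1) (hk : 0 < k)
    (hB : B y y = ((-(c : ℚ) / n : ℚ) : AddCircle (1 : ℚ))) : HasGramPresentation B := by
  have hnq : (n : ℚ) = k * c + 1 := by exact_mod_cast hn
  have hn0 : (n : ℚ) ≠ 0 := by rw [hnq]; positivity
  refine ⟨Fin k, inferInstance, inferInstance, of fun i j : Fin k ↦ pathEntry k c i j,
    -- The `min` term is the Green's function of the path alone; the product is the rank one
    -- correction for the `c` extra edges. Modulo 1 only the correction survives, and it is the Gram
    -- matrix of the multiples `(i + 1) • y`.
    of fun i j : Fin k ↦ (min (i + 1) (j + 1) : ℕ) - c * (i + 1 : ℕ) * (j + 1 : ℕ) / n,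
    fun i ↦ ((i : ℕ) + 1) • y, ?_, ?_, ?_, ?_, ?_, ?_⟩
  · intro i j
    simp only [of_apply, pathEntry]
    split_ifs <;> omega
  · intro i j hij
    have : (i : ℕ) ≠ j := fun h ↦ hij (Fin.ext h)
    simp only [of_apply, pathEntry, if_neg this]
    split_ifs <;> norm_num
  · intro i
    -- A row sum is the value of the Laplacian on the function that is 1 away from `none`.
    have := sum_pathEntry (R := ℤ) k c (fun j ↦ if j = 0 then 0 else 1) rfl i.2
    simp only [Nat.add_eq_zero_iff, one_ne_zero, and_false, if_false, mul_one, Int.cast_id,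
      OfNat.ofNat_ne_zero] at this
    simp only [of_apply]
    rw [this]
    split_ifs <;> linarith
  · ext i l
    have := sum_pathEntry (R := ℚ) k c
      (fun j ↦ ((min j (l + 1) : ℕ) : ℚ) - c * j * (l + 1 : ℕ) / n) (by simp) i.2
    rw [mul_apply]
    refine this.trans ?_
    have hi := i.2
    have hl := l.2
    rw [one_apply]
    simp only [Fin.ext_iff]
    generalize (i : ℕ) = i at *
    generalize (l : ℕ) = l at *
    rcases lt_trichotomy i l with h | h | h
    · rw [min_eq_left (by omega), min_eq_left (by omega), min_eq_left (by omega),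
        if_neg (by omega), if_neg (by omega), if_neg (by omega)]
      push_cast
      ring
    · subst h
      rw [min_self, min_eq_right (by omega), min_eq_left (by omega), if_pos rfl]
      split_ifs with hik
      · have hik' : (k : ℚ) = i + 1 := by exact_mod_cast hik.symm
        push_cast
        field_simp
        rw [hnq, hik']
        ring
      · push_cast
        ring
    · rw [min_eq_right (by omega), min_eq_right (by omega), min_eq_right (by omega), if_neg h.ne']
      split_ifs with hik
      · have hik' : (k : ℚ) = i + 1 := by exact_mod_cast hik.symm
        push_cast
        field_simp
        rw [hnq, hik']
        ring
      · push_cast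
        ring
  · rw [eq_top_iff, ← hy, AddSubgroup.closure_le, Set.singleton_subset_iff]
    exact AddSubgroup.subset_closure ⟨⟨0, hk⟩, by simp⟩
  · intro i j
    rw [map_nsmul, map_nsmul, AddMonoidHom.nsmul_apply, hB, of_apply, ← AddCircle.coe_nsmul,
      ← AddCircle.coe_nsmul, AddCircle.coe_sub]
    rw [show (((min ((i : ℕ) + 1) (j + 1) : ℕ) : ℚ) : AddCircle (1 : ℚ)) = 0 from
      coe_intCast (min ((i : ℕ) + 1) (j + 1) : ℕ), zero_sub, ← AddCircle.coe_neg]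
    refine congrArg _ ?_
    simp only [nsmul_eq_mul]
    push_cast
    ring

/-- The matrix with rows `(c, -1)` and `(-1, 3)` has determinant `3 * c - 1 = n`. Since `3 * c` is 1
modulo `n`, the second generator has to be `c • y`. -/
lemma hasGramPresentation_of_three {y : Γ} (hy : AddSubgroup.closure {y} = ⊤) {n c : ℕ}
    (hn : n + 1 = 3 * c) (hB : B y y = ((3 / n : ℚ) : AddCircle (1 : ℚ))) :
    HasGramPresentation B := by
  have hnq : (n : ℚ) = 3 * c - 1 := by
    rw [eq_sub_iff_add_eq]
    exact_mod_cast hn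
  have hn0 : (n : ℚ) ≠ 0 := by
    have : n ≠ 0 := by omega
    exact_mod_cast this
  refine ⟨Fin 2, inferInstance, inferInstance, !![(c : ℤ), -1; -1, 3],
    !![3 / (n : ℚ), 1 / n; 1 / n, c / n], ![y, c • y], ?_, ?_, ?_, ?_, ?_, ?_⟩
  · simp [Fin.forall_fin_two]
  · simp [Fin.forall_fin_two]
  · simp only [Fin.forall_fin_two, Fin.sum_univ_two]
    simp
    omega
  · ext i j
    fin_cases i <;> fin_cases j <;> simp [mul_apply, Fin.sum_univ_two] <;> field_simp <;>
      rw [hnq] <;> ring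
  · rw [eq_top_iff, ← hy, AddSubgroup.closure_le, Set.singleton_subset_iff]
    exact AddSubgroup.subset_closure ⟨0, rfl⟩
  · have hadd : ∀ (k : ℤ) (u v : ℚ), u = k + v → (u : AddCircle (1 : ℚ)) = v := by
      rintro k u v rfl
      rw [AddCircle.coe_add, coe_intCast, zero_add]
    have h1 : c • ((3 / n : ℚ) : AddCircle (1 : ℚ)) = ((1 / n : ℚ) : AddCircle (1 : ℚ)) := by
      rw [← AddCircle.coe_nsmul]
      refine hadd 1 _ _ ?_
      rw [nsmul_eq_mul]
      field_simp
      rw [hnq]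
      push_cast
      ring
    have h2 : c • ((1 / n : ℚ) : AddCircle (1 : ℚ)) = ((c / n : ℚ) : AddCircle (1 : ℚ)) := by
      rw [← AddCircle.coe_nsmul]
      refine congrArg _ ?_
      rw [nsmul_eq_mul]
      ring
    simp [Fin.forall_fin_two, hB, h1, h2, -one_div]

end

end GraphJacobian

/-! ### Squares modulo prime powers, and realization of cyclic pairings. -/

namespace GraphJacobian

lemma isUnit_intCast_zmod_pow {p : ℕ} (hp : p.Prime) {u : ℤ} (hu : ¬ (p : ℤ) ∣ u) (r : ℕ) :
    IsUnit (u : ZMod (p ^ r)) := by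
  rw [ZMod.coe_int_isUnit_iff_isCoprime, Nat.cast_pow]
  exact ((Nat.prime_iff_prime_int.1 hp).coprime_iff_not_dvd.2 hu).pow_left

/-- An integer that is a nonzero square modulo an odd prime is a square modulo its powers. -/
lemma isSquare_zmod_pow {p : ℕ} (hp : p.Prime) (hp2 : p ≠ 2) {u : ℤ} (hu : ¬ (p : ℤ) ∣ u)
    (h : IsSquare (u : ZMod p)) (r : ℕ) : IsSquare (u : ZMod (p ^ r)) := by
  cases r with
  | zero =>
    have : Subsingleton (ZMod (p ^ 0)) := by rw [pow_zero]; infer_instance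
    exact ⟨0, Subsingleton.elim _ _⟩
  | succ r =>
    obtain ⟨s, hs⟩ := h
    obtain ⟨s, rfl⟩ := ZMod.intCast_surjective s
    have hdvd : (p : ℤ) ∣ u - s ^ 2 := by
      rw [← ZMod.intCast_zmod_eq_zero_iff_dvd]
      push_cast
      rw [hs]
      ring
    -- Raising `u ≡ s ^ 2` to the power `p ^ r` lifts it to a congruence modulo `p ^ (r + 1)`. As `p
    -- ^ r = 2 * m + 1` is odd, dividing by the square of the unit `u ^ m` exhibits `u` as a square.
    have h1 := dvd_sub_pow_of_dvd_sub hdvd r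
    obtain ⟨m, hm⟩ := (hp.odd_of_ne_two hp2).pow (n := r)
    have h2 : (u : ZMod (p ^ (r + 1))) * (u ^ m) ^ 2 = (s ^ p ^ r) ^ 2 := by
      have h3 : ((p ^ (r + 1) : ℕ) : ℤ) ∣ u ^ p ^ r - (s ^ 2) ^ p ^ r := by exact_mod_cast h1
      rw [← ZMod.intCast_zmod_eq_zero_iff_dvd] at h3
      push_cast at h3
      have h4 := sub_eq_zero.1 h3
      rw [pow_right_comm] at h4
      rw [← h4, hm]
      ring
    obtain ⟨v, hv⟩ := (isUnit_intCast_zmod_pow hp hu (r + 1)).pow m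
    refine ⟨s ^ p ^ r * ↑v⁻¹, ?_⟩
    rw [← hv] at h2
    calc (u : ZMod (p ^ (r + 1))) = u * (v : ZMod (p ^ (r + 1))) ^ 2 * (↑v⁻¹) ^ 2 := by
          rw [mul_assoc, ← mul_pow, v.mul_inv, one_pow, mul_one]
      _ = _ := by rw [h2]; ring

lemma coe_eq_coe_of_dvd {n : ℕ} (hn : n ≠ 0) {a b : ℤ} (h : (n : ℤ) ∣ a - b) :
    ((a / n : ℚ) : AddCircle (1 : ℚ)) = ((b / n : ℚ) : AddCircle (1 : ℚ)) := by
  obtain ⟨k, hk⟩ := h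
  have hnq : (n : ℚ) ≠ 0 := by exact_mod_cast hn
  have : (a / n : ℚ) = (k : ℤ) + b / n := by
    have : (a : ℚ) = n * k + b := by exact_mod_cast sub_eq_iff_eq_add.1 hk
    field_simp
    rw [this]
  rw [this, AddCircle.coe_add, coe_intCast, zero_add]

lemma exists_eq_coe_div {u : AddCircle (1 : ℚ)} {n : ℕ} (hn : n ≠ 0) (hu : n • u = 0) :
    ∃ a : ℤ, u = ((a / n : ℚ) : AddCircle (1 : ℚ)) := by
  obtain ⟨q, rfl⟩ := QuotientAddGroup.mk_surjective u
  obtain ⟨a, ha⟩ := (AddCircle.coe_eq_zero_iff 1).1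
    ((AddCircle.coe_nsmul 1 (n := n) (x := q)).trans hu)
  have hnq : (n : ℚ) ≠ 0 := by exact_mod_cast hn
  refine ⟨a, congrArg _ ?_⟩
  rw [eq_div_iff hnq, mul_comm]
  simpa using ha.symm

section

variable {Γ : Type*} [AddCommGroup Γ] {B : Γ →+ Γ →+ AddCircle (1 : ℚ)}

/-- Passing from `x` to `t • x` multiplies `a` by `t ^ 2`. If `w ^ 2 = a * b` modulo `p ^ r`, then
`t = w / a` turns `a` into `b`. -/
lemma exists_generator_of_isSquare {p r : ℕ} (hp : p.Prime) (hp2 : p ≠ 2) {x : Γ}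
    (hx : AddSubgroup.closure {x} = ⊤) (hx0 : (p ^ r) • x = 0) {a b : ℤ} (ha : ¬ (p : ℤ) ∣ a)
    (hb : ¬ (p : ℤ) ∣ b) (hB : B x x = ((a / (p ^ r : ℕ) : ℚ) : AddCircle (1 : ℚ)))
    (hab : IsSquare ((a * b : ℤ) : ZMod p)) :
    ∃ y, AddSubgroup.closure {y} = ⊤ ∧
      B y y = ((b / (p ^ r : ℕ) : ℚ) : AddCircle (1 : ℚ)) := by
  have hpp := Nat.prime_iff_prime_int.1 hp
  obtain ⟨w, hw⟩ := isSquare_zmod_pow hp hp2 (fun h ↦ (hpp.dvd_or_dvd h).elim ha hb) hab r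
  obtain ⟨α, hα⟩ := isUnit_intCast_zmod_pow hp ha r
  obtain ⟨t, ht⟩ := ZMod.intCast_surjective (w * (↑α⁻¹ : ZMod (p ^ r)))
  have hta : (t : ZMod (p ^ r)) ^ 2 * a = b := by
    push_cast at hw
    rw [ht, ← hα] at *
    calc (w * (↑α⁻¹ : ZMod (p ^ r))) ^ 2 * α = w * w * ↑α⁻¹ * (↑α⁻¹ * α) := by ring
      _ = α * b * ↑α⁻¹ := by rw [α.inv_mul, mul_one, hw]
      _ = (α * ↑α⁻¹) * b := by ring
      _ = b := by rw [α.mul_inv, one_mul]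
  have htu : IsUnit (t : ZMod (p ^ r)) := by
    have := isUnit_intCast_zmod_pow hp hb r
    rw [← hta, pow_two, mul_assoc] at this
    exact isUnit_of_mul_isUnit_left this
  obtain ⟨t', ht'⟩ := htu.exists_left_inv
  obtain ⟨t', rfl⟩ := ZMod.intCast_surjective t'
  refine ⟨t • x, ?_, ?_⟩
  · rw [eq_top_iff, ← hx, AddSubgroup.closure_le, Set.singleton_subset_iff]
    have h1 : ((p ^ r : ℕ) : ℤ) ∣ t' * t - 1 := by
      rw [← ZMod.intCast_zmod_eq_zero_iff_dvd]
      push_cast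
      rw [ht', sub_self]
    obtain ⟨k, hk⟩ := h1
    have h2 : t' • t • x = x := by
      rw [smul_smul, sub_eq_iff_eq_add.1 hk, add_smul, one_smul, mul_comm, mul_smul, natCast_zsmul,
        hx0, smul_zero, zero_add]
    have h3 := AddSubgroup.zsmul_mem _ (AddSubgroup.mem_closure_singleton_self (t • x)) t'
    rwa [h2] at h3
  · rw [map_zsmul, map_zsmul, AddMonoidHom.smul_apply, hB, ← AddCircle.coe_zsmul,
      ← AddCircle.coe_zsmul]
    rw [← coe_eq_coe_of_dvd (pow_ne_zero r hp.ne_zero) (a := t ^ 2 * a) (b := b)]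
    · refine congrArg _ ?_
      simp only [zsmul_eq_mul]
      push_cast
      ring
    · rw [← ZMod.intCast_zmod_eq_zero_iff_dvd]
      push_cast
      rw [hta, sub_self]

/-- If -1 and 2 are both squares, then `p` is 1 modulo 8. It is then 2 modulo 3, and quadratic
reciprocity makes 3 a nonresidue. -/
lemma not_isSquare_of_not_modEq {p : ℕ} (hp : p.Prime) (hp2 : p ≠ 2) (h24 : ¬ p ≡ 1 [MOD 24]) :
    p % 4 = 3 ∧ ¬ IsSquare (-1 : ZMod p) ∨ ¬ IsSquare (2 : ZMod p) ∨
      p % 3 = 2 ∧ ¬ IsSquare (3 : ZMod p) := by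
  have : Fact p.Prime := ⟨hp⟩
  have hodd := hp.odd_of_ne_two hp2
  rw [ZMod.exists_sq_eq_neg_one_iff, ZMod.exists_sq_eq_two_iff hp2]
  by_cases h4 : p % 4 = 3
  · exact .inl ⟨h4, fun h ↦ h h4⟩
  by_cases h8 : p % 8 = 1
  · right; right
    have h41 : p % 4 = 1 := by omega
    have h3 : p % 3 ≠ 0 := fun h ↦ by
      rcases (Nat.dvd_prime hp).1 (Nat.dvd_of_mod_eq_zero h) with h | h <;> omega
    have h32 : p % 3 = 2 := by
      rw [Nat.ModEq] at h24
      omega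
    refine ⟨h32, ?_⟩
    have := ZMod.exists_sq_eq_prime_iff_of_mod_four_eq_one (q := 3) h41 (by norm_num)
    rw [Nat.cast_ofNat] at this
    rw [this, ← ZMod.natCast_mod, h32]
    decide
  · right; left
    rw [Nat.odd_iff] at hodd
    omega

/-- In a path graph `k * c ≡ -1` modulo `p`, so `-c` and `k` have the same quadratic character.
Nonsquare `a` are matched by `k = p ^ r - 1`, 2 or 3, according to which of -1, 2, 3 is a
nonresidue. The choice `k = 3` needs `p ^ r ≡ 1` modulo 3; the other residue is left to
`hasGramPresentation_of_three`. -/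
lemma hasGramPresentation_of_cyclic {p r : ℕ} (hp : p.Prime) (hp2 : p ≠ 2)
    (h24 : ¬ p ≡ 1 [MOD 24]) (hr : r ≠ 0) {x : Γ} (hx : AddSubgroup.closure {x} = ⊤)
    (hx0 : (p ^ r) • x = 0) {a : ℤ} (ha : ¬ (p : ℤ) ∣ a)
    (hB : B x x = ((a / (p ^ r : ℕ) : ℚ) : AddCircle (1 : ℚ))) : HasGramPresentation B := by
  have : Fact p.Prime := ⟨hp⟩
  have hpn : p ∣ p ^ r := dvd_pow_self p hr
  have h3n : 3 ≤ p ^ r := by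
    have := hp.two_le
    have : p ≤ p ^ r := Nat.le_of_dvd (pow_pos hp.pos r) hpn
    omega
  have hodd : Odd (p ^ r) := (hp.odd_of_ne_two hp2).pow
  have path : ∀ k c : ℕ, p ^ r = k * c + 1 → IsSquare ((a * k : ℤ) : ZMod p) →
      HasGramPresentation B := by
    intro k c hn hsq
    have hk : 0 < k := Nat.pos_of_ne_zero (by rintro rfl; omega)
    have hkc : (k : ZMod p) * c = -1 := by
      have : ((p ^ r : ℕ) : ZMod p) = 0 := (ZMod.natCast_eq_zero_iff _ _).2 hpn
      rw [hn] at this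
      push_cast at this
      exact eq_neg_of_add_eq_zero_left this
    have hc : ¬ (p : ℤ) ∣ -c := by
      rw [← ZMod.intCast_zmod_eq_zero_iff_dvd]
      intro hc
      push_cast at hc
      rw [neg_eq_zero.1 hc, mul_zero] at hkc
      exact neg_ne_zero.2 one_ne_zero hkc.symm
    obtain ⟨y, hy, hBy⟩ := exists_generator_of_isSquare hp hp2 hx hx0 ha hc hB (by
      obtain ⟨s, hs⟩ := hsq
      refine ⟨s * c, ?_⟩
      push_cast at hs ⊢
      linear_combination (c : ZMod p) ^ 2 * hs - a * c * hkc)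
    exact hasGramPresentation_of_path hy hn hk (by rw [hBy]; simp)
  by_cases hasq : IsSquare (a : ZMod p)
  · exact path 1 (p ^ r - 1) (by omega) (by simpa using hasq)
  have hmul : ∀ q : ℤ, ¬ IsSquare (q : ZMod p) → IsSquare ((a * q : ℤ) : ZMod p) := fun q hq ↦ by
    have h1 := legendreSym.mul p a q
    rw [(legendreSym.eq_neg_one_iff p).2 hasq, (legendreSym.eq_neg_one_iff p).2 hq] at h1
    by_contra h
    rw [(legendreSym.eq_neg_one_iff p).2 h] at h1
    norm_num at h1
  rcases not_isSquare_of_not_modEq hp hp2 h24 with ⟨-, h⟩ | h | ⟨h3, h⟩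
  · refine path (p ^ r - 1) 1 (by omega) ?_
    have : ((p ^ r : ℕ) : ZMod p) = 0 := (ZMod.natCast_eq_zero_iff _ _).2 hpn
    have h1 := hmul (-1) (by simpa using h)
    push_cast [Nat.cast_sub (show 1 ≤ p ^ r by omega)] at this h1 ⊢
    rwa [this, zero_sub]
  · obtain ⟨m, hm⟩ := hodd
    exact path 2 m hm (hmul 2 (by simpa using h))
  · have hn3 : p ^ r % 3 ≠ 0 := fun h0 ↦ by
      have := Nat.Prime.dvd_of_dvd_pow Nat.prime_three (Nat.dvd_of_mod_eq_zero h0)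
      omega
    rcases (show p ^ r % 3 = 1 ∨ p ^ r % 3 = 2 by omega) with h1 | h2
    · exact path 3 (p ^ r / 3) (by omega) (hmul 3 (by simpa using h))
    · obtain ⟨y, hy, hBy⟩ := exists_generator_of_isSquare hp hp2 hx hx0 ha (b := 3) (by
        intro h
        have h' : p ∣ 3 := by exact_mod_cast h
        rcases (Nat.dvd_prime Nat.prime_three).1 h' with h | h
        · exact hp.ne_one h
        · omega) hB (hmul 3 (by simpa using h))
      exact hasGramPresentation_of_three hy (n := p ^ r) (c := (p ^ r + 1) / 3) (by omega) (by simpa using hBy)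

/-! ### Splitting off a cyclic summand -/

/-- Let `p ^ (e + 1)` be the exact power of `p` in the exponent. Nondegeneracy gives two elements
killed by `p ^ (e + 1)` whose pairing is not killed by `p ^ e`. Since `p` is odd, polarization gives
one such element paired with itself. -/
lemma exists_selfPairing_primitive [Finite Γ] [Nontrivial Γ]
    (hsymm : ∀ x y, B x y = B y x) (hnondeg : ∀ x, (∀ y, B x y = 0) → x = 0)
    (hodd : Odd (Nat.card Γ)) :
    ∃ (p r : ℕ) (x : Γ) (a : ℤ), p.Prime ∧ p ≠ 2 ∧ p ∣ Nat.card Γ ∧ r ≠ 0 ∧ p ^ r • x = 0 ∧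
      ¬ (p : ℤ) ∣ a ∧ B x x = ((a / (p ^ r : ℕ) : ℚ) : AddCircle (1 : ℚ)) := by
  obtain ⟨p, hp, hpc⟩ := Nat.exists_prime_and_dvd (Finite.one_lt_card (α := Γ)).ne'
  have : Fact p.Prime := ⟨hp⟩
  have hp2 : p ≠ 2 := by
    rintro rfl
    exact (Nat.not_even_iff_odd.2 hodd) (even_iff_two_dvd.2 hpc)
  obtain ⟨e, m, hpm, hN⟩ := Nat.exists_eq_pow_mul_and_not_dvd
    (AddMonoid.exponent_ne_zero_of_finite (G := Γ)) p hp.ne_one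
  obtain ⟨z, hz⟩ := exists_prime_addOrderOf_dvd_card' p hpc
  have hpN : p ∣ AddMonoid.exponent Γ := hz ▸ AddMonoid.addOrder_dvd_exponent z
  obtain ⟨e, rfl⟩ : ∃ e', e = e' + 1 := Nat.exists_eq_succ_of_ne_zero (by
    rintro rfl
    rw [hN, pow_zero, one_mul] at hpN
    exact hpm hpN)
  have hm0 : 0 < m := Nat.pos_of_ne_zero fun h ↦ hpm (h ▸ dvd_zero p)
  obtain ⟨y₀, hy₀⟩ : ∃ y : Γ, (p ^ e * m) • y ≠ 0 := by
    by_contra! h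
    have := Nat.le_of_dvd (by have := hp.pos; positivity)
      (AddMonoid.exponent_dvd_of_forall_nsmul_eq_zero h)
    rw [hN] at this
    have h2 := Nat.le_of_mul_le_mul_right this hm0
    exact absurd h2 (not_le.2 (Nat.pow_lt_pow_right hp.one_lt e.lt_succ_self))
  have hkill : ∀ w : Γ, p ^ (e + 1) • m • w = 0 := fun w ↦ by
    rw [smul_smul, ← hN, AddMonoid.exponent_nsmul_eq_zero]
  obtain ⟨z₀, hz₀⟩ : ∃ z, B (p ^ e • m • y₀) z ≠ 0 := by
    by_contra! h
    exact hy₀ (by rw [mul_smul]; exact hnondeg _ h)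
  -- an element of order dividing both `p` and a number prime to `p` vanishes
  have hcop : ∀ (k : ℕ) (u : AddCircle (1 : ℚ)), ¬ p ∣ k → p • u = 0 → k • u = 0 → u = 0 := by
    intro k u hk h1 h2
    have h3 := Nat.dvd_gcd (addOrderOf_dvd_of_nsmul_eq_zero h1) (addOrderOf_dvd_of_nsmul_eq_zero h2)
    rwa [(hp.coprime_iff_not_dvd.2 hk).gcd_eq_one, Nat.dvd_one, AddMonoid.addOrderOf_eq_one_iff]
      at h3
  have hyz : p ^ e • B (m • y₀) (m • z₀) ≠ 0 := by
    intro h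
    refine hz₀ (hcop m _ hpm ?_ ?_)
    · rw [← AddMonoidHom.nsmul_apply, ← map_nsmul, smul_smul, ← pow_succ', hkill]
      simp
    · rw [← map_nsmul (B _), map_nsmul B, AddMonoidHom.nsmul_apply, h]
  obtain ⟨x, hx0, hx⟩ : ∃ x : Γ, p ^ (e + 1) • x = 0 ∧ p ^ e • B x x ≠ 0 := by
    by_contra! h
    have h1 := h _ (hkill y₀)
    have h2 := h _ (hkill z₀)
    have h3 := h (m • y₀ + m • z₀) (by rw [smul_add, hkill, hkill, add_zero])
    -- Expanding the pairing of the sum with itself shows that 2 kills `p ^ e • B (m • y₀) (m •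
    -- z₀)`. So does `p`, which is odd.
    refine hyz (hcop 2 _ (fun h ↦ hp2 ((Nat.prime_dvd_prime_iff_eq hp Nat.prime_two).1 h)) ?_ ?_)
    · rw [smul_smul, ← pow_succ', ← AddMonoidHom.nsmul_apply, ← map_nsmul, hkill]
      simp
    · rw [map_add, map_add, AddMonoidHom.add_apply, AddMonoidHom.add_apply, hsymm (m • z₀) (m • y₀), smul_add,
        smul_add, smul_add, h1, h2, zero_add, add_zero] at h3
      rw [two_smul, h3]
  have hpe : p ^ (e + 1) ≠ 0 := pow_ne_zero _ hp.ne_zero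
  obtain ⟨a, ha⟩ := exists_eq_coe_div (u := B x x) hpe (by
    rw [← map_nsmul, hx0, map_zero])
  refine ⟨p, e + 1, x, a, hp, hp2, hpc, e.succ_ne_zero, hx0, ?_, ha⟩
  rintro ⟨b, rfl⟩
  refine hx ?_
  rw [ha, ← AddCircle.coe_nsmul]
  have : p ^ e • (((p * b : ℤ) : ℚ) / (p ^ (e + 1) : ℕ)) = (b : ℚ) := by
    have hpq : (p : ℚ) ≠ 0 := by exact_mod_cast hp.ne_zero
    rw [nsmul_eq_mul]
    push_cast
    field_simp
    ring
  rw [this, coe_intCast]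

/-- As `a` is a unit modulo `p ^ r`, the group generated by `x` splits off orthogonally. The
complement `K = (B x).ker` is smaller and inherits every hypothesis, so induction on the order
applies. -/
lemma hasGramPresentation_of_odd {Γ : Type*} [AddCommGroup Γ] [Finite Γ]
    (B : Γ →+ Γ →+ AddCircle (1 : ℚ))
    (hsymm : ∀ x y, B x y = B y x) (hnondeg : ∀ x, (∀ y, B x y = 0) → x = 0)
    (hodd : Odd (Nat.card Γ))
    (hprime : ∀ p : ℕ, p.Prime → p ≡ 1 [MOD 24] → ¬ p ∣ Nat.card Γ) :
    HasGramPresentation B := by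
  induction hc : Nat.card Γ using Nat.strong_induction_on generalizing Γ with
  | _ n ih =>
    rcases subsingleton_or_nontrivial Γ with _ | _
    · exact hasGramPresentation_of_subsingleton
    obtain ⟨p, r, x, a, hp, hp2, hpc, hr, hx0, ha, hB⟩ :=
      exists_selfPairing_primitive hsymm hnondeg hodd
    have hpr : p ^ r ≠ 0 := pow_ne_zero _ hp.ne_zero
    let H := AddSubgroup.zmultiples x
    let K := (B x).ker
    have hsplit : ∀ y, ∃ k : ℤ, y - k • x ∈ K := by
      intro y
      obtain ⟨b, hb⟩ := exists_eq_coe_div (u := B x y) hpr (by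
        rw [← AddMonoidHom.nsmul_apply, ← map_nsmul, hx0, map_zero, AddMonoidHom.zero_apply])
      obtain ⟨c, hc⟩ := (isUnit_intCast_zmod_pow hp ha r).exists_right_inv
      obtain ⟨c, rfl⟩ := ZMod.intCast_surjective c
      -- Here `c` inverts `a` modulo `p ^ r`, so this is the projection coefficient `⟨x, y⟩ / ⟨x,
      -- x⟩`.
      refine ⟨b * c, ?_⟩
      rw [AddMonoidHom.mem_ker, map_sub, map_zsmul, hb, hB, ← AddCircle.coe_zsmul, sub_eq_zero]
      rw [coe_eq_coe_of_dvd hpr (a := b) (b := b * c * a)]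
      · refine congrArg _ ?_
        rw [zsmul_eq_mul]
        push_cast
        ring
      · rw [← ZMod.intCast_zmod_eq_zero_iff_dvd]
        push_cast
        rw [mul_assoc, mul_comm (c : ZMod (p ^ r)), hc, mul_one, sub_self]
    have hBx : B x x ≠ 0 := by
      intro h0
      obtain ⟨k, hk⟩ := (AddCircle.coe_eq_zero_iff 1).1 (hB.symm.trans h0)
      have hq : ((p ^ r : ℕ) : ℚ) ≠ 0 := by exact_mod_cast hpr
      rw [zsmul_eq_mul, mul_one, eq_div_iff hq] at hk
      have hk' : k * (p ^ r : ℕ) = a := by exact_mod_cast hk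
      exact ha (hk' ▸ Dvd.dvd.mul_left (by exact_mod_cast dvd_pow_self p hr) k)
    have hKc : Nat.card K ∣ Nat.card Γ := AddSubgroup.card_addSubgroup_dvd_card K
    have hKlt : Nat.card K < Nat.card Γ := by
      refine lt_of_le_of_ne (Nat.le_of_dvd Nat.card_pos hKc) fun h ↦ hBx ?_
      have : x ∈ K := by
        rw [AddSubgroup.card_eq_iff_eq_top K |>.1 h]
        trivial
      exact this
    have hH : HasGramPresentation (restrict B H) := by
      refine hasGramPresentation_of_cyclic hp hp2 (fun h ↦ hprime p hp h hpc) hr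
        (x := ⟨x, AddSubgroup.mem_zmultiples x⟩) ?_ (Subtype.ext hx0) ha hB
      rw [← AddSubgroup.zmultiples_eq_closure, eq_top_iff]
      rintro ⟨_, k, rfl⟩ -
      exact ⟨k, rfl⟩
    have horth : ∀ h ∈ H, ∀ k ∈ K, B h k = 0 := by
      rintro _ ⟨j, rfl⟩ k hk
      change B (j • x) k = 0
      rw [map_zsmul, AddMonoidHom.smul_apply, AddMonoidHom.mem_ker.1 hk, smul_zero]
    have hK : HasGramPresentation (restrict B K) := by
      refine ih _ (hc ▸ hKlt) (restrict B K) (fun y z ↦ hsymm y z) ?_ (hodd.of_dvd_nat hKc)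
        (fun q hq h24 hqK ↦ hprime q hq h24 (hqK.trans hKc)) rfl
      -- An element of `K` orthogonal to `K` is also orthogonal to `x`, hence to all of `Γ`.
      rintro ⟨z, hz⟩ hzK
      refine Subtype.ext (hnondeg z fun y ↦ ?_)
      obtain ⟨k, hk⟩ := hsplit y
      have h1 : B z (y - k • x) = 0 := hzK ⟨_, hk⟩
      have h2 : B z (k • x) = 0 := by
        rw [hsymm]
        exact horth _ ⟨k, rfl⟩ z hz
      rw [← sub_add_cancel y (k • x), map_add, h1, h2, add_zero]
    refine hH.sup hK ?_ hsymm horth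
    rw [eq_top_iff]
    intro y _
    obtain ⟨k, hk⟩ := hsplit y
    rw [← add_sub_cancel (k • x) y]
    exact AddSubgroup.add_mem_sup ⟨k, rfl⟩ hk

end

end GraphJacobian

theorem theorem1 {Γ : Type*} [AddCommGroup Γ] [Finite Γ]
    (B : Γ →+ Γ →+ AddCircle (1 : ℚ))
    (hsymm : ∀ x y, B x y = B y x)
    (hnondeg : ∀ x, (∀ y, B x y = 0) → x = 0)
    (hodd : Odd (Nat.card Γ))
    (hprime : ∀ p : ℕ, p.Prime → p ≡ 1 [MOD 24] → ¬ p ∣ Nat.card Γ) :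
    ∃ (V E : Type) (G : Graph V E) (_ : Fintype (Graph.vertexSet G))
      (_ : Finite (Graph.edgeSet G)),
      G.Loopless ∧ GraphJacobian.Connected G ∧
        ∃ φ : Γ ≃+ GraphJacobian.Jac G,
          ∀ x y, GraphJacobian.monodromyPairing G (φ x) (φ y) = B x y := by
  obtain ⟨ι, _, _, M, N, g, h⟩ :=
    GraphJacobian.hasGramPresentation_of_odd B hsymm hnondeg hodd hprime
  exact ⟨_, _, GraphJacobian.laplacianGraph h.symm, inferInstance,
    GraphJacobian.finite_edgeSet_ofWeight,
    GraphJacobian.loopless_ofWeight GraphJacobian.weight_self, h.connected,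
    h.equivJac hnondeg, h.monodromyPairing_equivJac hnondeg⟩
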